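/- **Theorem 2.2 (Upper decay estimate for weak solutions).** Let $H$ be a real Hilbert space and let $A$ be a self-adjoint nonnegative linear operator on $H$ with dense domain $D(A)$. Let $A^{1/2}$ be its nonnegative self-adjoint square root, and equip $D(A^{1/2})$ with the norm $|u|_{D(A^{1/2})}=(|u|^2+|A^{1/2}u|^2)^{1/2}$. Assume the following. - $F:D(A^{1/2})\to[0,+\infty)$ is a nonnegative function with $F(0)=0$. - $F$ has a gradient $\nabla F:D(A^{1/2})\to H$, in the sense that for every $u\in D(A^{1/2})$ $$\lim_{|v|_{D(A^{1/2})}\to 0}\frac{F(u+v)-F(u)-\langle\nabla F(u),v\rangle}{|v|}=0 .$$ - $\nabla F$ is locally Lipschitz continuous, in the sense that there is a function $L:\mathbb{R}^2\to\mathbb{R}$, bounded on bounded sets, with $$|\nabla F(u)-\nabla F(v)|\le L\big(|u|_{D(A^{1/2})},|v|_{D(A^{1/2})}\big)\,|u-v|_{D(A^{1/2})}\qquad\forall u,v\in D(A^{1/2}).$$ - There is a constant $K>0$ such that $\langle\nabla F(u),u\rangle\ge K\,F(u)$ for every $u\in D(A^{1/2})$. - There are $p>0$ and a function $R_1:\mathbb{R}\to\mathbb{R}$,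 bounded on bounded sets, such that $$|u|^{p+2}\le R_1\big(|u|_{D(A^{1/2})}\big)\,\big(|A^{1/2}u|^2+F(u)\big)\qquad\forall u\in D(A^{1/2}).$$ Let $(u_0,u_1)\in D(A^{1/2})\times H$ and let $u$ be the global weak solution of $$u''(t)+u'(t)+Au(t)+\nabla F(u(t))=0\quad(t\ge 0),\qquad u(0)=u_0,\quad u'(0)=u_1,$$ that is, $u\in C^0([0,+\infty);D(A^{1/2}))\cap C^1([0,+\infty);H)$ takes these initial data and satisfies, for every $\varphi\in D(A^{1/2})$ and every $t\ge 0$, $$\frac{d}{dt}\langle u'(t),\varphi\rangle+\langle u'(t),\varphi\rangle+\langle A^{1/2}u(t),A^{1/2}\varphi\rangle+\langle\nabla F(u(t)),\varphi\rangle=0 .$$ Then there exist constants $M_1$ and $M_2$ such that, for every $t\ge 0$, $$|u'(t)|^2+|A^{1/2}u(t)|^2+F(u(t))\le\frac{M_1}{(1+t)^{1+2/p}},\qquad |u(t)|\le\frac{M_2}{(1+t)^{1/p}} .$$ -/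

import Mathlib

open Set Filter Topology
open scoped InnerProductSpace

noncomputable section

namespace DissipativeHyperbolic

variable {H : Type*} [NormedAddCommGroup H] [InnerProductSpace ℝ H] [CompleteSpace H]

/-- The (possibly unbounded) operator `A` is nonnegative: `⟨A x, x⟩ ≥ 0` on its domain. -/
def IsNonneg (A : H →ₗ.[ℝ] H) : Prop :=
  ∀ x : A.domain, 0 ≤ ⟪A x, (x : H)⟫_ℝ

/-- `B` is a nonnegative self-adjoint square root of `A`: `B` is densely defined, self-adjoint,
nonnegative, and `B ∘ B = A` as unbounded operators, that is, `x ∈ D(A)` and `A x = y` hold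
exactly when `x ∈ D(B)`, `B x ∈ D(B)` and `B (B x) = y`. -/
structure IsNonnegSqrt (A B : H →ₗ.[ℝ] H) : Prop where
  dense : Dense (B.domain : Set H)
  selfAdjoint : IsSelfAdjoint B
  nonneg : IsNonneg B
  sq : ∀ x y : H, (x, y) ∈ A.graph ↔ ∃ z : H, (x, z) ∈ B.graph ∧ (z, y) ∈ B.graph

open Classical in
/-- The operator `A^{1/2}`: the nonnegative self-adjoint square root of `A`. A nonnegative
self-adjoint operator has exactly one (spectral theorem); for other operators the value is
the junk value `⊥`, with domain `{0}`. -/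
def sqrtOp (A : H →ₗ.[ℝ] H) : H →ₗ.[ℝ] H :=
  if h : ∃ B, IsNonnegSqrt A B then h.choose else ⊥

/-- The space `D(A^{1/2})`. It is a type of its own, since it carries the graph norm and not
the norm of `H`. -/
def DSqrt (A : H →ₗ.[ℝ] H) : Type _ := (sqrtOp A).domain

namespace DSqrt

variable (A : H →ₗ.[ℝ] H)

instance : AddCommGroup (DSqrt A) := inferInstanceAs (AddCommGroup (sqrtOp A).domain)

instance : Module ℝ (DSqrt A) := inferInstanceAs (Module ℝ (sqrtOp A).domain)

/-- The inclusion `D(A^{1/2}) → H`. -/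
def toH : DSqrt A →ₗ[ℝ] H := (sqrtOp A).domain.subtype

/-- The map `u ↦ A^{1/2} u` from `D(A^{1/2})` to `H`. -/
def root : DSqrt A →ₗ[ℝ] H := (sqrtOp A).toFun

/-- The map `u ↦ (u, A^{1/2} u)` into the Hilbert sum `H ⊕ H`. -/
def toGraph : DSqrt A →ₗ[ℝ] WithLp 2 (H × H) :=
  (WithLp.linearEquiv 2 ℝ (H × H)).symm.toLinearMap ∘ₗ (toH A).prod (root A)

theorem toGraph_injective : Function.Injective (toGraph A) := by
  intro u v h
  have h1 : toH A u = toH A v :=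
    congrArg Prod.fst (congrArg (WithLp.linearEquiv 2 ℝ (H × H)) h)
  exact Subtype.ext h1

/-- The norm of `D(A^{1/2})` is the graph norm, induced by `u ↦ (u, A^{1/2} u)`. -/
instance : NormedAddCommGroup (DSqrt A) :=
  NormedAddCommGroup.induced (DSqrt A) (WithLp 2 (H × H)) (toGraph A) (toGraph_injective A)

instance : NormedSpace ℝ (DSqrt A) :=
  NormedSpace.induced ℝ (DSqrt A) (WithLp 2 (H × H)) (toGraph A)

/-- The norm of `D(A^{1/2})` is `(|u|² + |A^{1/2} u|²)^{1/2}`. -/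
theorem norm_eq (u : DSqrt A) : ‖u‖ = √(‖toH A u‖ ^ 2 + ‖root A u‖ ^ 2) :=
  WithLp.prod_norm_eq_of_L2 (toGraph A u)

end DSqrt

open DSqrt

/-- `gradF` is the gradient of `F : D(A^{1/2}) → ℝ`: for every `u`,
`(F(u+v) - F(u) - ⟨gradF(u), v⟩) / |v| → 0` as `v → 0` in `D(A^{1/2})`, where `|v|` is the norm
of `H`. -/
def IsGradient {A : H →ₗ.[ℝ] H} (F : DSqrt A → ℝ) (gradF : DSqrt A → H) : Prop :=
  ∀ u : DSqrt A,
    Tendsto (fun v : DSqrt A => (F (u + v) - F u - ⟪gradF u, toH A v⟫_ℝ) / ‖toH A v‖)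
      (𝓝[≠] 0) (𝓝 0)

/-- A function is bounded on bounded sets. -/
def BoundedOnBounded {X Y : Type*} [Bornology X] [Bornology Y] (f : X → Y) : Prop :=
  ∀ s : Set X, Bornology.IsBounded s → Bornology.IsBounded (f '' s)

/-- Local Lipschitz continuity of a map `D(A^{1/2}) → H`, with a Lipschitz constant
`L(|u|_{D(A^{1/2})}, |v|_{D(A^{1/2})})` that is bounded on bounded sets. -/
def LocLipschitz {A : H →ₗ.[ℝ] H} (G : DSqrt A → H) : Prop :=
  ∃ L : ℝ × ℝ → ℝ, BoundedOnBounded L ∧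
    ∀ u v : DSqrt A, ‖G u - G v‖ ≤ L (‖u‖, ‖v‖) * ‖u - v‖

/-- `u` is a global weak solution of `u'' + u' + A u + gradF(u) = 0`, `u(0) = u₀`, `u'(0) = u₁`,
with time derivative `u'`: it lies in `C⁰([0,∞); D(A^{1/2})) ∩ C¹([0,∞); H)`, and for every test
vector `φ ∈ D(A^{1/2})` one has, for all `t ≥ 0` (with one-sided derivatives at `t = 0`),
`d/dt ⟨u'(t), φ⟩ + ⟨u'(t), φ⟩ + ⟨A^{1/2} u(t), A^{1/2} φ⟩ + ⟨gradF(u(t)), φ⟩ = 0`.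
The values of `u` and `u'` at negative times play no role. -/
structure IsWeakSolution {A : H →ₗ.[ℝ] H} (gradF : DSqrt A → H) (u₀ : DSqrt A) (u₁ : H)
    (u : ℝ → DSqrt A) (u' : ℝ → H) : Prop where
  continuousOn : ContinuousOn u (Ici 0)
  hasDeriv : ∀ t : ℝ, 0 ≤ t → HasDerivWithinAt (fun s => toH A (u s)) (u' t) (Ici 0) t
  continuousOn_deriv : ContinuousOn u' (Ici 0)
  init : u 0 = u₀
  init_deriv : u' 0 = u₁
  weak : ∀ φ : DSqrt A, ∀ t : ℝ, 0 ≤ t →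
    HasDerivWithinAt (fun s => ⟪u' s, toH A φ⟫_ℝ)
      (-(⟪u' t, toH A φ⟫_ℝ + ⟪root A (u t), root A φ⟫_ℝ + ⟪gradF (u t), toH A φ⟫_ℝ))
      (Ici 0) t

end DissipativeHyperbolic

end

/-!
The energy `E = (|u'|² + |A^{1/2} u|²) / 2 + F(u)` of a weak solution dissipates, `E' = -|u'|²`, and
testing the equation with `u` gives, for `P = ⟨u', u⟩`,
`P' = |u'|² - P - |A^{1/2} u|² - ⟨∇F(u), u⟩`. The decay follows from these two equations.

The energy identity is where the low regularity of `u` matters most: `u'` is not a test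
function. The linear part of the equation commutes with the forward averages `h⁻¹ ∫_t^{t+h}`, and
the average of `u` has its time derivative, a difference quotient of `u`, in `D(A^{1/2})`. The
identity is therefore exact for the averages, and `h → 0` gives `energy_identity`. Averages of `u`
exist in `D(A^{1/2})` since this space is complete, `A^{1/2}` being a closed operator. The term `F(u)`
is added by the chain rule `IsGradient.hasDerivAt_comp`.

First, `E + P + |u|² / 2` is nonincreasing, so that `u` is bounded in `D(A^{1/2})`
(`bounded_of_energy`), and the last assumption becomes `|u|^{p+2} ≤ C E` with a constant `C`. Put
`γ = p / (p + 2)`. By this bound, `E^γ |P|` is at most a multiple of `E` and `E^{γ-1} |P|` is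
bounded (`cross_term_bounds`). Hence, for small `ε`, the modified energy `Y = E + ε E^γ P` lies between
`E / 2` and `2 E`, and it satisfies `Y' ≤ -κ Y^{1+γ}` (`modified_energy_deriv_le`). Integration gives
`Y ≤ M (1 + t)^{-1/γ}`, where `1/γ = 1 + 2/p` (`energy_decay`). The decay of `|u|` is that of
`(C E)^{1/(p+2)}`.
-/

/-! ### Forward averages -/

/-- The forward average `h⁻¹ ∫_t^{t+h} f` of a curve `f`. -/
noncomputable def forwardAverage {E : Type*} [NormedAddCommGroup E] [NormedSpace ℝ E]
    (h : ℝ) (f : ℝ → E) (t : ℝ) : E :=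
  h⁻¹ • ∫ s in t..t + h, f s

section ForwardAverage

variable {E : Type*} [NormedAddCommGroup E] [NormedSpace ℝ E]

theorem norm_forwardAverage_le {f : ℝ → E} {h t C : ℝ} (hh : 0 < h)
    (hC : ∀ s ∈ Icc t (t + h), ‖f s‖ ≤ C) : ‖forwardAverage h f t‖ ≤ C := by
  have h1 : ‖∫ s in t..t + h, f s‖ ≤ C * |t + h - t| := by
    refine intervalIntegral.norm_integral_le_of_norm_le_const fun s hs => hC s ?_
    rw [uIoc_of_le (by linarith)] at hs
    exact Ioc_subset_Icc_self hs
  rw [add_sub_cancel_left, abs_of_pos hh] at h1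
  rw [forwardAverage, norm_smul, norm_inv, Real.norm_eq_abs, abs_of_pos hh,
    inv_mul_le_iff₀ hh, mul_comm]
  exact h1

variable [CompleteSpace E]

theorem hasDerivAt_forwardAverage {f : ℝ → E} (hf : Continuous f) (h t : ℝ) :
    HasDerivAt (forwardAverage h f) (h⁻¹ • (f (t + h) - f t)) t := by
  have hprim : ∀ x, HasDerivAt (fun x => ∫ s in (0 : ℝ)..x, f s) (f x) x := fun x =>
    (hf.integral_hasStrictDerivAt 0 x).hasDerivAt
  have heq : forwardAverage h f =
      fun x => h⁻¹ • ((∫ s in (0 : ℝ)..x + h, f s) - ∫ s in (0 : ℝ)..x, f s) := by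
    funext x
    rw [forwardAverage, intervalIntegral.integral_interval_sub_left
      (hf.intervalIntegrable _ _) (hf.intervalIntegrable _ _)]
  rw [heq]
  exact (((hprim (t + h)).comp_add_const t h).sub (hprim t)).const_smul h⁻¹

theorem continuous_forwardAverage {f : ℝ → E} (hf : Continuous f) (h : ℝ) :
    Continuous (forwardAverage h f) :=
  continuous_iff_continuousAt.2 fun t => (hasDerivAt_forwardAverage hf h t).continuousAt

theorem tendsto_forwardAverage {f : ℝ → E} (hf : Continuous f) (t : ℝ) :
    Tendsto (fun h => forwardAverage h f t) (𝓝[>] 0) (𝓝 (f t)) := by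
  have h1 := (hf.integral_hasStrictDerivAt t t).hasDerivAt.tendsto_slope_zero_right
  simpa [forwardAverage] using h1

end ForwardAverage

/-! ### The energy identity for the linear equation -/

section EnergyIdentity

variable {V H K : Type*} [NormedAddCommGroup V] [NormedSpace ℝ V]
  [NormedAddCommGroup H] [InnerProductSpace ℝ H] [CompleteSpace H]
  [NormedAddCommGroup K] [InnerProductSpace ℝ K]
  {i : V →L[ℝ] H} {b : V →L[ℝ] K} {u : ℝ → V} {u' g : ℝ → H}

/-- Averaging the velocity gives a difference quotient of the solution, which takes its values in
the energy space. -/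
theorem forwardAverage_velocity (hu : Continuous u) (hu' : Continuous u')
    (hderiv : ∀ t, 0 < t → HasDerivAt (fun s => i (u s)) (u' t) t)
    {h t : ℝ} (hh : 0 < h) (ht : 0 ≤ t) :
    forwardAverage h u' t = i (h⁻¹ • (u (t + h) - u t)) := by
  rw [forwardAverage, map_smul, map_sub, intervalIntegral.integral_eq_sub_of_hasDerivAt_of_le
    (f := fun s => i (u s)) (by linarith) (i.continuous.comp hu).continuousOn
    (fun x hx => hderiv x (ht.trans_lt hx.1)) (hu'.intervalIntegrable _ _)]

variable [CompleteSpace V]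

/-- The averaged equation. It holds pointwise in time, since the average of the velocity is
differentiable. -/
theorem inner_deriv_forwardAverage (hu : Continuous u) (hu' : Continuous u') (hg : Continuous g)
    (hweak : ∀ φ t, 0 < t →
      HasDerivAt (fun s => ⟪u' s, i φ⟫_ℝ) (-(⟪g t, i φ⟫_ℝ + ⟪b (u t), b φ⟫_ℝ)) t)
    {h t : ℝ} (hh : 0 < h) (ht : 0 ≤ t) (φ : V) :
    ⟪i φ, h⁻¹ • (u' (t + h) - u' t)⟫_ℝ =
      -(⟪i φ, forwardAverage h g t⟫_ℝ + ⟪b φ, b (forwardAverage h u t)⟫_ℝ) := by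
  have hcg : Continuous fun s => ⟪g s, i φ⟫_ℝ := hg.inner continuous_const
  have hcb : Continuous fun s => ⟪b (u s), b φ⟫_ℝ := (b.continuous.comp hu).inner continuous_const
  have h1 := intervalIntegral.integral_eq_sub_of_hasDerivAt_of_le
    (f := fun s => ⟪u' s, i φ⟫_ℝ) (a := t) (b := t + h) (by linarith)
    (hu'.inner continuous_const).continuousOn
    (fun x hx => hweak φ x (ht.trans_lt hx.1)) ((hcg.add hcb).neg.intervalIntegrable _ _)
  rw [intervalIntegral.integral_neg, intervalIntegral.integral_add (hcg.intervalIntegrable _ _)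
    (hcb.intervalIntegrable _ _)] at h1
  have h2 : ∫ s in t..t + h, ⟪g s, i φ⟫_ℝ = ⟪i φ, ∫ s in t..t + h, g s⟫_ℝ := by
    simpa [real_inner_comm] using
      (innerSL ℝ (i φ)).intervalIntegral_comp_comm (hg.intervalIntegrable t (t + h))
  have h3 : ∫ s in t..t + h, ⟪b (u s), b φ⟫_ℝ = ⟪b φ, b (∫ s in t..t + h, u s)⟫_ℝ := by
    simpa [real_inner_comm] using
      ((innerSL ℝ (b φ)).comp b).intervalIntegral_comp_comm (hu.intervalIntegrable t (t + h))
  rw [h2, h3] at h1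
  simp only [forwardAverage, map_smul, inner_smul_right, inner_sub_right]
  rw [real_inner_comm, real_inner_comm (u' t), ← h1]
  ring

theorem hasDerivAt_energy_forwardAverage (hu : Continuous u) (hu' : Continuous u')
    (hg : Continuous g) (hderiv : ∀ t, 0 < t → HasDerivAt (fun s => i (u s)) (u' t) t)
    (hweak : ∀ φ t, 0 < t →
      HasDerivAt (fun s => ⟪u' s, i φ⟫_ℝ) (-(⟪g t, i φ⟫_ℝ + ⟪b (u t), b φ⟫_ℝ)) t)
    {h t : ℝ} (hh : 0 < h) (ht : 0 ≤ t) :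
    HasDerivAt (fun s => ‖forwardAverage h u' s‖ ^ 2 + ‖b (forwardAverage h u s)‖ ^ 2)
      (-2 * ⟪forwardAverage h g t, forwardAverage h u' t⟫_ℝ) t := by
  have h1 := (hasDerivAt_forwardAverage hu' h t).norm_sq
  have h2 := (b.hasFDerivAt.comp_hasDerivAt t (hasDerivAt_forwardAverage hu h t)).norm_sq
  refine (h1.add h2).congr_deriv ?_
  have h3 := inner_deriv_forwardAverage hu hu' hg hweak hh ht (h⁻¹ • (u (t + h) - u t))
  rw [← forwardAverage_velocity hu hu' hderiv hh ht] at h3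
  rw [h3, Function.comp_apply, real_inner_comm (forwardAverage h u' t),
    real_inner_comm (b (forwardAverage h u t))]
  ring

/-- The energy identity for weak solutions of `u'' + b*b u + g = 0`. The solution need not be
regular enough for `u'` to be a test function: the identity is exact for the forward averages
`h⁻¹ ∫_t^{t+h} u`, and it passes to the limit as `h → 0`. -/
theorem energy_identity (hu : Continuous u) (hu' : Continuous u')
    (hg : Continuous g) (hderiv : ∀ t, 0 < t → HasDerivAt (fun s => i (u s)) (u' t) t)
    (hweak : ∀ φ t, 0 < t →
      HasDerivAt (fun s => ⟪u' s, i φ⟫_ℝ) (-(⟪g t, i φ⟫_ℝ + ⟪b (u t), b φ⟫_ℝ)) t)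
    {T : ℝ} (hT : 0 ≤ T) :
    ‖u' T‖ ^ 2 + ‖b (u T)‖ ^ 2 - (‖u' 0‖ ^ 2 + ‖b (u 0)‖ ^ 2) =
      ∫ t in (0 : ℝ)..T, -2 * ⟪g t, u' t⟫_ℝ := by
  obtain ⟨C, hC⟩ := (isCompact_Icc (a := (0 : ℝ)) (b := T + 1)).exists_bound_of_continuousOn
    hg.continuousOn
  obtain ⟨D, hD⟩ := (isCompact_Icc (a := (0 : ℝ)) (b := T + 1)).exists_bound_of_continuousOn
    hu'.continuousOn
  have hC0 : 0 ≤ C := (norm_nonneg _).trans (hC 0 ⟨le_rfl, by linarith⟩)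
  have hcont : ∀ h, Continuous fun t =>
      -2 * ⟪forwardAverage h g t, forwardAverage h u' t⟫_ℝ := fun h =>
    continuous_const.mul ((continuous_forwardAverage hg h).inner (continuous_forwardAverage hu' h))
  have hlim : ∀ t, Tendsto
      (fun h => ‖forwardAverage h u' t‖ ^ 2 + ‖b (forwardAverage h u t)‖ ^ 2) (𝓝[>] 0)
      (𝓝 (‖u' t‖ ^ 2 + ‖b (u t)‖ ^ 2)) := fun t =>
    ((tendsto_forwardAverage hu' t).norm.pow 2).add
      (((b.continuous.tendsto _).comp (tendsto_forwardAverage hu t)).norm.pow 2)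
  have hint : Tendsto
      (fun h => ∫ t in (0 : ℝ)..T, -2 * ⟪forwardAverage h g t, forwardAverage h u' t⟫_ℝ)
      (𝓝[>] 0) (𝓝 (∫ t in (0 : ℝ)..T, -2 * ⟪g t, u' t⟫_ℝ)) := by
    refine intervalIntegral.tendsto_integral_filter_of_dominated_convergence
      (fun _ => 2 * (C * D)) (.of_forall fun h => (hcont h).aestronglyMeasurable) ?_
      intervalIntegrable_const ?_
    · filter_upwards [Ioo_mem_nhdsGT (zero_lt_one' ℝ)] with h hh
      refine .of_forall fun t ht => ?_
      rw [uIoc_of_le hT] at ht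
      have hsub : ∀ s ∈ Icc t (t + h), s ∈ Icc (0 : ℝ) (T + 1) := fun s hs =>
        ⟨ht.1.le.trans hs.1, by linarith [hs.2, ht.2, hh.2]⟩
      rw [norm_mul, norm_neg, Real.norm_ofNat]
      gcongr
      exact (norm_inner_le_norm _ _).trans (mul_le_mul
        (norm_forwardAverage_le hh.1 fun s hs => hC s (hsub s hs))
        (norm_forwardAverage_le hh.1 fun s hs => hD s (hsub s hs)) (norm_nonneg _) hC0)
    · refine .of_forall fun t _ => ?_
      exact ((tendsto_forwardAverage hg t).inner (tendsto_forwardAverage hu' t)).const_mul _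
  refine tendsto_nhds_unique ((hlim T).sub (hlim 0)) (hint.congr' ?_)
  filter_upwards [self_mem_nhdsWithin] with h hh
  refine intervalIntegral.integral_eq_sub_of_hasDerivAt
    (f := fun s => ‖forwardAverage h u' s‖ ^ 2 + ‖b (forwardAverage h u s)‖ ^ 2) (fun t ht => ?_)
    ((hcont h).intervalIntegrable _ _)
  rw [uIcc_of_le hT] at ht
  exact hasDerivAt_energy_forwardAverage hu hu' hg hderiv hweak hh ht.1

/-- The differential form of `energy_identity`. -/
theorem hasDerivAt_energy (hu : Continuous u) (hu' : Continuous u')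
    (hg : Continuous g) (hderiv : ∀ t, 0 < t → HasDerivAt (fun s => i (u s)) (u' t) t)
    (hweak : ∀ φ t, 0 < t →
      HasDerivAt (fun s => ⟪u' s, i φ⟫_ℝ) (-(⟪g t, i φ⟫_ℝ + ⟪b (u t), b φ⟫_ℝ)) t)
    {t : ℝ} (ht : 0 < t) :
    HasDerivAt (fun s => ‖u' s‖ ^ 2 + ‖b (u s)‖ ^ 2) (-2 * ⟪g t, u' t⟫_ℝ) t := by
  have hcont : Continuous fun t => -2 * ⟪g t, u' t⟫_ℝ := continuous_const.mul (hg.inner hu')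
  refine ((hcont.integral_hasStrictDerivAt 0 t).hasDerivAt.add_const
    (‖u' 0‖ ^ 2 + ‖b (u 0)‖ ^ 2)).congr_of_eventuallyEq ?_
  filter_upwards [Ioi_mem_nhds ht] with s hs
  rw [← energy_identity hu hu' hg hderiv hweak (le_of_lt hs), sub_add_cancel]

end EnergyIdentity

/-! ### The modified energy -/

theorem antitoneOn_Ici_of_hasDerivAt_nonpos {f f' : ℝ → ℝ} (hc : ContinuousOn f (Ici 0))
    (hd : ∀ t, 0 < t → HasDerivAt f (f' t) t) (hle : ∀ t, 0 < t → f' t ≤ 0) :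
    AntitoneOn f (Ici 0) := by
  refine antitoneOn_of_deriv_nonpos (convex_Ici 0) hc ?_ ?_ <;> rw [interior_Ici]
  · exact fun t ht => (hd t ht).differentiableAt.differentiableWithinAt
  · intro t ht
    rw [(hd t ht).deriv]
    exact hle t ht

/-- A positive solution of `Y' ≤ -κ Y^{1+γ}` satisfies `(Y^{-γ})' ≥ γκ`. -/
theorem rpow_neg_add_le_of_deriv_le {Y Y' : ℝ → ℝ} {γ κ T : ℝ} (hγ : 0 < γ) (hT : 0 ≤ T)
    (hc : ContinuousOn Y (Icc 0 T)) (hpos : ∀ t ∈ Icc 0 T, 0 < Y t)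
    (hd : ∀ t ∈ Ioo 0 T, HasDerivAt Y (Y' t) t)
    (hle : ∀ t ∈ Ioo 0 T, Y' t ≤ -κ * Y t ^ (1 + γ)) :
    Y 0 ^ (-γ) + γ * κ * T ≤ Y T ^ (-γ) := by
  have hd' : ∀ t ∈ Ioo 0 T, HasDerivAt (fun t => Y t ^ (-γ) - γ * κ * t)
      (Y' t * (-γ) * Y t ^ (-γ - 1) - γ * κ) t := fun t ht => by
    have h1 := (hd t ht).rpow_const (p := -γ) (.inl (hpos t (Ioo_subset_Icc_self ht)).ne')
    have h2 := (hasDerivAt_id t).const_mul (γ * κ)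
    rw [mul_one] at h2
    exact h1.sub h2
  have hmono : MonotoneOn (fun t => Y t ^ (-γ) - γ * κ * t) (Icc 0 T) := by
    refine monotoneOn_of_deriv_nonneg (convex_Icc 0 T) ?_ ?_ ?_
    · exact (hc.rpow_const fun t ht => .inl (hpos t ht).ne').sub
        (continuous_const.mul continuous_id).continuousOn
    · rw [interior_Icc]
      exact fun t ht => (hd' t ht).differentiableAt.differentiableWithinAt
    · rw [interior_Icc]
      intro t ht
      have hY := hpos t (Ioo_subset_Icc_self ht)
      rw [(hd' t ht).deriv]
      have h1 : Y t ^ (1 + γ) * Y t ^ (-γ - 1) = 1 := by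
        rw [← Real.rpow_add hY]; ring_nf; exact Real.rpow_zero _
      have h2 := mul_le_mul_of_nonneg_right (hle t ht) (mul_nonneg hγ.le
        (Real.rpow_nonneg hY.le (-γ - 1)))
      linear_combination h2 - γ * κ * h1
  have := hmono (left_mem_Icc.2 hT) (right_mem_Icc.2 hT) hT
  simp only [mul_zero, sub_zero] at this
  linarith

/-- A bound `w^{p+2} ≤ C e` by the energy `e` controls the cross term `P = ⟨u', u⟩`. -/
theorem cross_term_bounds {p C e e₀ a w P : ℝ} (hp : 0 < p) (hC : 0 ≤ C) (he : 0 < e)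
    (hle : e ≤ e₀) (hw : 0 ≤ w) (hae : a ^ 2 ≤ 2 * e) (hP : |P| ≤ a * w)
    (hwe : w ^ (p + 2) ≤ C * e) :
    e ^ (p / (p + 2) - 1) * |P| ≤ 2 * C ^ (1 / (p + 2)) * e₀ ^ (1 / 2 - 1 / (p + 2)) ∧
      (e ^ (p / (p + 2))) ^ 2 * w ^ 2 ≤ (C ^ (1 / (p + 2))) ^ 2 * e ^ (1 + p / (p + 2)) := by
  set q := 1 / (p + 2) with hq
  set c := C ^ q
  have hc : 0 ≤ c := Real.rpow_nonneg hC q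
  have hγ : p / (p + 2) = 1 - 2 * q := by rw [hq]; field_simp; ring
  have hq2 : q ≤ 1 / 2 := by rw [hq]; gcongr; linarith
  rw [hγ]
  have hw1 : w ≤ c * e ^ q := by
    rw [← Real.mul_rpow hC he.le]
    have h := Real.rpow_le_rpow (Real.rpow_nonneg hw _) hwe (by positivity : 0 ≤ q)
    rwa [← Real.rpow_mul hw, hq, mul_one_div_cancel (by positivity), Real.rpow_one] at h
  have ha1 : a ≤ 2 * e ^ (1 / 2 : ℝ) := by
    refine le_of_sq_le_sq ?_ (by positivity)
    rw [mul_pow, ← Real.sqrt_eq_rpow, Real.sq_sqrt he.le]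
    linarith
  constructor
  · calc e ^ (1 - 2 * q - 1) * |P|
        ≤ e ^ (1 - 2 * q - 1) * ((2 * e ^ (1 / 2 : ℝ)) * (c * e ^ q)) := by
          gcongr
          exact hP.trans (mul_le_mul ha1 hw1 hw (by positivity))
      _ = 2 * c * (e ^ (1 - 2 * q - 1) * e ^ (1 / 2 : ℝ) * e ^ q) := by ring
      _ = 2 * c * e ^ (1 / 2 - q) := by
          rw [← Real.rpow_add he, ← Real.rpow_add he]; ring_nf
      _ ≤ 2 * c * e₀ ^ (1 / 2 - q) := by
          gcongr
  · calc (e ^ (1 - 2 * q)) ^ 2 * w ^ 2 ≤ (e ^ (1 - 2 * q)) ^ 2 * (c * e ^ q) ^ 2 := by gcongr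
      _ = c ^ 2 * (e ^ (1 - 2 * q) * e ^ (1 - 2 * q) * e ^ q * e ^ q) := by ring
      _ = c ^ 2 * e ^ (1 + (1 - 2 * q)) := by
          rw [← Real.rpow_add he, ← Real.rpow_add he, ← Real.rpow_add he]; ring_nf

/-- The derivative of the modified energy `e + ε e^γ P` along the flow, with `X = e^γ` and
`Z = e^{γ-1}`. The dissipation `-a²` absorbs all terms with a factor `a`, if `ε` is small. -/
theorem modified_energy_deriv_le {a b f G P w e X Z γ k c D D₂ ε : ℝ}
    (hγ : 0 ≤ γ) (hγ1 : γ ≤ 1) (hk1 : k ≤ 1) (hε : 0 ≤ ε)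
    (he : e = (a ^ 2 + b ^ 2) / 2 + f) (hG : k * f ≤ G)
    (hP : |P| ≤ a * w) (hX : 0 ≤ X) (hXD : X ≤ D₂) (hZ : 0 ≤ Z) (hZP : Z * |P| ≤ D)
    (hXw : X ^ 2 * w ^ 2 ≤ c ^ 2 * (e * X)) (he0 : 0 ≤ e)
    (hε1 : ε * (D + 2 * D₂) ≤ 1 / 4) (hε2 : ε * c ^ 2 ≤ k / 2) :
    -a ^ 2 + ε * (-a ^ 2 * γ * Z * P + X * (a ^ 2 - P - b ^ 2 - G)) ≤ -(ε * k / 2) * (e * X) := by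
  have h1 : -a ^ 2 * γ * Z * P ≤ a ^ 2 * D := by
    have hz : γ * (Z * -P) ≤ D := by
      have h0 : Z * -P ≤ Z * |P| := by gcongr; exact neg_le_abs P
      have h2 : γ * (Z * |P|) ≤ 1 * (Z * |P|) := by gcongr
      nlinarith [mul_le_mul_of_nonneg_left h0 hγ]
    nlinarith [mul_le_mul_of_nonneg_left hz (sq_nonneg a)]
  -- Young's inequality for the damping term of the equation tested with `u`.
  have h2 : ε * (X * -P) ≤ a ^ 2 / 4 + ε ^ 2 * (c ^ 2 * (e * X)) := by
    have h3 : ε * (X * -P) ≤ ε * (X * (a * w)) := by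
      gcongr; exact (neg_le_abs P).trans hP
    nlinarith [sq_nonneg (a / 2 - ε * X * w), mul_le_mul_of_nonneg_left hXw (sq_nonneg ε)]
  have h4 : X * a ^ 2 ≤ D₂ * a ^ 2 := by gcongr
  have h5 : X * (-b ^ 2 - G) ≤ -k * (e * X) + D₂ * a ^ 2 := by
    have h6 : -b ^ 2 - G ≤ -k * e + a ^ 2 := by
      rw [he]; nlinarith [sq_nonneg a, sq_nonneg b]
    nlinarith [mul_le_mul_of_nonneg_left h6 hX]
  have h7 : ε * (ε * c ^ 2) * (e * X) ≤ ε * (k / 2) * (e * X) := by gcongr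
  have h8 : ε * (D + 2 * D₂) * a ^ 2 ≤ 1 / 4 * a ^ 2 := by gcongr
  nlinarith [mul_le_mul_of_nonneg_left h1 hε, mul_le_mul_of_nonneg_left h4 hε,
    mul_le_mul_of_nonneg_left h5 hε, sq_nonneg a]

/-- Decay of the energy, from the equations for the energy `E` and for `P = ⟨u', u⟩`. Here `a`, `b`,
`w`, `f`, `G` stand for `|u'|`, `|A^{1/2} u|`, `|u|`, `F(u)`, `⟨∇F(u), u⟩`. -/
theorem energy_decay {E P a b w f G : ℝ → ℝ} {p K C : ℝ} (hp : 0 < p) (hK : 0 < K) (hC : 0 ≤ C)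
    (hEc : ContinuousOn E (Ici 0)) (hPc : ContinuousOn P (Ici 0))
    (hE : ∀ t, 0 < t → HasDerivAt E (-a t ^ 2) t)
    (hPd : ∀ t, 0 < t → HasDerivAt P (a t ^ 2 - P t - b t ^ 2 - G t) t)
    (hEeq : ∀ t, E t = (a t ^ 2 + b t ^ 2) / 2 + f t)
    (hf : ∀ t, 0 ≤ f t) (hw : ∀ t, 0 ≤ w t)
    (hP : ∀ t, |P t| ≤ a t * w t) (hG : ∀ t, K * f t ≤ G t)
    (hwE : ∀ t, 0 ≤ t → w t ^ (p + 2) ≤ C * E t) :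
    ∃ M, 0 ≤ M ∧ ∀ t, 0 ≤ t → E t ≤ M / (1 + t) ^ (1 + 2 / p) := by
  have hE0 : ∀ t, 0 ≤ E t := fun t => by
    rw [hEeq]; have := hf t; positivity
  have hanti : AntitoneOn E (Ici 0) :=
    antitoneOn_Ici_of_hasDerivAt_nonpos hEc hE fun t _ => neg_nonpos.2 (sq_nonneg _)
  rcases (hE0 0).eq_or_lt with h00 | h00
  · refine ⟨0, le_rfl, fun t ht => ?_⟩
    rw [zero_div, h00]
    exact hanti self_mem_Ici ht ht
  set γ := p / (p + 2) with hγdef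
  have hγ : 0 < γ := by positivity
  have hγ1 : γ ≤ 1 := by rw [hγdef, div_le_one (by positivity)]; linarith
  have hγinv : (-γ)⁻¹ = -(1 + 2 / p) := by rw [hγdef]; field_simp
  set c := C ^ (1 / (p + 2)) with hc
  have hc0 : 0 ≤ c := Real.rpow_nonneg hC _
  set D := 2 * c * E 0 ^ (1 / 2 - 1 / (p + 2)) with hD
  set D₂ := E 0 ^ γ with hD₂
  have hD0 : 0 ≤ D := by positivity
  have hD₂0 : 0 ≤ D₂ := by positivity
  set k := min K 1 with hk
  have hk0 : 0 < k := lt_min hK one_pos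
  obtain ⟨ε, hε, hε1, hε2⟩ : ∃ ε, 0 < ε ∧ ε * (D + 2 * D₂) ≤ 1 / 4 ∧ ε * c ^ 2 ≤ k / 2 := by
    refine ⟨min (1 / (4 * (D + 2 * D₂ + 1))) (k / (2 * (c ^ 2 + 1))), by positivity, ?_, ?_⟩
    · calc _ ≤ 1 / (4 * (D + 2 * D₂ + 1)) * (D + 2 * D₂ + 1) := by
            exact mul_le_mul (min_le_left _ _) (by linarith) (by positivity) (by positivity)
        _ = 1 / 4 := by field_simp
    · calc _ ≤ k / (2 * (c ^ 2 + 1)) * (c ^ 2 + 1) := by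
            exact mul_le_mul (min_le_right _ _) (by linarith) (by positivity) (by positivity)
        _ = k / 2 := by field_simp
  set κ := ε * k / 2 / 2 ^ (1 + γ) with hκ
  have hκ0 : 0 < κ := by positivity
  set m := min ((2 * E 0) ^ (-γ)) (γ * κ) with hm
  have hm0 : 0 < m := lt_min (by positivity) (by positivity)
  refine ⟨2 * m ^ (-(1 + 2 / p)), by positivity, fun T hT => ?_⟩
  -- Once the energy vanishes it stays zero, so only times with positive energy on `[0, T]` matter.
  rcases (hE0 T).eq_or_lt with hT0 | hT0
  · rw [← hT0]; positivity
  have hpos : ∀ t ∈ Icc 0 T, 0 < E t := fun t ht =>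
    hT0.trans_le (hanti (mem_Ici.2 ht.1) (mem_Ici.2 hT) ht.2)
  have hb : ∀ t ∈ Icc 0 T, E t ^ (γ - 1) * |P t| ≤ D ∧
      (E t ^ γ) ^ 2 * w t ^ 2 ≤ c ^ 2 * E t ^ (1 + γ) := fun t ht =>
    cross_term_bounds hp hC (hpos t ht) (hanti self_mem_Ici (mem_Ici.2 ht.1) ht.1) (hw t)
      (by rw [hEeq]; linarith [hf t, sq_nonneg (b t)]) (hP t) (hwE t ht.1)
  have hXE : ∀ t ∈ Icc 0 T, E t * E t ^ γ = E t ^ (1 + γ) := fun t ht => by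
    rw [Real.rpow_add (hpos t ht), Real.rpow_one]
  have hpert : ∀ t ∈ Icc 0 T, |ε * (E t ^ γ * P t)| ≤ E t / 4 := fun t ht => by
    have hEt := hpos t ht
    have h1 : E t ^ γ = E t ^ (γ - 1) * E t := by
      rw [Real.rpow_sub_one hEt.ne', div_mul_cancel₀ _ hEt.ne']
    have h2 : ε * D ≤ 1 / 4 := by nlinarith
    rw [abs_mul, abs_mul, abs_of_pos hε, abs_of_pos (Real.rpow_pos_of_pos hEt γ), h1]
    calc _ = ε * (E t ^ (γ - 1) * |P t|) * E t := by ring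
      _ ≤ ε * D * E t := by gcongr; exact (hb t ht).1
      _ ≤ 1 / 4 * E t := by gcongr
      _ = _ := by ring
  set Y : ℝ → ℝ := fun t => E t + ε * (E t ^ γ * P t) with hY
  have hYl : ∀ t ∈ Icc 0 T, E t / 2 ≤ Y t := fun t ht => by
    have := neg_le_of_abs_le (hpert t ht)
    simp only [hY]; linarith [hE0 t]
  have hYu : ∀ t ∈ Icc 0 T, Y t ≤ 2 * E t := fun t ht => by
    have := le_of_abs_le (hpert t ht)
    simp only [hY]; linarith [hE0 t]
  have hYpos : ∀ t ∈ Icc 0 T, 0 < Y t := fun t ht => by linarith [hYl t ht, hpos t ht]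
  have hsub : Icc 0 T ⊆ Ici (0 : ℝ) := Icc_subset_Ici_self
  have hEcT := hEc.mono hsub
  have key := rpow_neg_add_le_of_deriv_le (Y := Y) (κ := κ) hγ hT
    (hEcT.add (continuousOn_const.mul
      ((hEcT.rpow_const fun t ht => .inl (hpos t ht).ne').mul (hPc.mono hsub)))) hYpos
    (fun t ht => (hE t ht.1).add ((((hE t ht.1).rpow_const (p := γ)
      (.inl (hpos t (Ioo_subset_Icc_self ht)).ne')).mul (hPd t ht.1)).const_mul ε)) ?_
  · have h0 : 0 ∈ Icc 0 T := left_mem_Icc.2 hT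
    have hTT : T ∈ Icc 0 T := right_mem_Icc.2 hT
    have h1 : (2 * E 0) ^ (-γ) ≤ Y 0 ^ (-γ) :=
      Real.rpow_le_rpow_of_nonpos (hYpos 0 h0) (hYu 0 h0) (by linarith)
    have h2 : m * (1 + T) ≤ Y T ^ (-γ) := by
      nlinarith [min_le_left ((2 * E 0) ^ (-γ)) (γ * κ), min_le_right ((2 * E 0) ^ (-γ)) (γ * κ)]
    have h3 := Real.rpow_le_rpow_of_nonpos (by positivity) h2
      (z := (-γ)⁻¹) (inv_nonpos.2 (by linarith))
    rw [Real.rpow_rpow_inv (hYpos T hTT).le (by linarith), hγinv,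
      Real.mul_rpow hm0.le (by positivity)] at h3
    rw [div_eq_mul_inv, ← Real.rpow_neg (by positivity)]
    linarith [hYl T hTT]
  · intro t ht
    have ht' := Ioo_subset_Icc_self ht
    have hEt := hpos t ht'
    have h1 := modified_energy_deriv_le (e := E t) (X := E t ^ γ) (Z := E t ^ (γ - 1)) (k := k)
      (G := G t) hγ.le hγ1 (min_le_right _ _) hε.le (hEeq t)
      ((mul_le_mul_of_nonneg_right (min_le_left _ _) (hf t)).trans (hG t)) (hP t)
      (by positivity) (Real.rpow_le_rpow hEt.le (hanti self_mem_Ici (mem_Ici.2 ht'.1) ht'.1) hγ.le)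
      (by positivity) (hb t ht').1 (by rw [hXE t ht']; exact (hb t ht').2) hEt.le hε1 hε2
    have h2 : Y t ^ (1 + γ) ≤ 2 ^ (1 + γ) * E t ^ (1 + γ) := by
      rw [← Real.mul_rpow two_pos.le hEt.le]
      exact Real.rpow_le_rpow (hYpos t ht').le (hYu t ht') (by positivity)
    have h3 : κ * Y t ^ (1 + γ) ≤ ε * k / 2 * E t ^ (1 + γ) := by
      calc _ ≤ κ * (2 ^ (1 + γ) * E t ^ (1 + γ)) := by gcongr
        _ = _ := by rw [hκ]; field_simp
    rw [hXE t ht'] at h1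
    simp only [neg_mul] at h1 ⊢
    linarith

/-- A bound for `w = |u|` along the flow, given `(w²)' = 2P` and the equations for the energy `E`
and for `P = ⟨u', u⟩`: the function `E + P + w²/2` is nonincreasing. -/
theorem bounded_of_energy {E P a b w G : ℝ → ℝ}
    (hEc : ContinuousOn E (Ici 0)) (hPc : ContinuousOn P (Ici 0))
    (hwc : ContinuousOn (fun t => w t ^ 2) (Ici 0))
    (hE : ∀ t, 0 < t → HasDerivAt E (-a t ^ 2) t)
    (hPd : ∀ t, 0 < t → HasDerivAt P (a t ^ 2 - P t - b t ^ 2 - G t) t)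
    (hwd : ∀ t, 0 < t → HasDerivAt (fun t => w t ^ 2) (2 * P t) t)
    (haE : ∀ t, a t ^ 2 ≤ 2 * E t) (hP : ∀ t, |P t| ≤ a t * w t) (hG : ∀ t, 0 ≤ G t) :
    ∃ C, ∀ t, 0 ≤ t → w t ^ 2 ≤ C := by
  have hanti : AntitoneOn (fun t => E t + P t + w t ^ 2 / 2) (Ici 0) :=
    antitoneOn_Ici_of_hasDerivAt_nonpos ((hEc.add hPc).add (hwc.div_const 2))
      (fun t ht => ((hE t ht).add (hPd t ht)).add ((hwd t ht).div_const 2))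
      fun t _ => by linarith [hG t, sq_nonneg (b t)]
  refine ⟨4 * (2 * E 0 + P 0 + w 0 ^ 2 / 2), fun t ht => ?_⟩
  have hE' : E t ≤ E 0 := antitoneOn_Ici_of_hasDerivAt_nonpos hEc hE
    (fun t _ => neg_nonpos.2 (sq_nonneg _)) self_mem_Ici ht ht
  have h1 : E t + P t + w t ^ 2 / 2 ≤ E 0 + P 0 + w 0 ^ 2 / 2 := hanti self_mem_Ici ht ht
  have h2 := neg_le_of_abs_le (hP t)
  nlinarith [sq_nonneg (a t - w t / 2), haE t]

namespace DissipativeHyperbolic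

variable {H : Type*} [NormedAddCommGroup H] [InnerProductSpace ℝ H] [CompleteSpace H]

/-! ### The space `D(A^{1/2})` -/

/-- The square root is closed, since it is self-adjoint. The value `⊥` that `sqrtOp` takes on
operators without a square root is closed too. -/
theorem isClosed_sqrtOp (A : H →ₗ.[ℝ] H) : (sqrtOp A).IsClosed := by
  unfold sqrtOp
  split_ifs with h
  · exact h.choose_spec.selfAdjoint.isClosed
  · have hbot : ((⊥ : H →ₗ.[ℝ] H).graph : Set (H × H)) = {0} := by
      ext ⟨x, y⟩
      simp only [SetLike.mem_coe, LinearPMap.mem_graph_iff, mem_singleton_iff]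
      constructor
      · rintro ⟨z, hz, hy⟩
        have hz0 : z = 0 := Subtype.ext ((Submodule.mem_bot ℝ).1 z.2)
        rw [hz0] at hz hy
        rw [Prod.mk_eq_zero]
        exact ⟨hz.symm, hy.symm.trans (LinearPMap.map_zero _)⟩
      · intro hxy
        rw [Prod.mk_eq_zero] at hxy
        exact ⟨0, hxy.1.symm, (LinearPMap.map_zero _).trans hxy.2.symm⟩
    rw [LinearPMap.IsClosed, hbot]
    exact isClosed_singleton

namespace DSqrt

variable {A : H →ₗ.[ℝ] H}

theorem range_toGraph :
    range (toGraph A) = WithLp.ofLp ⁻¹' ((sqrtOp A).graph : Set (H × H)) := by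
  ext x
  rw [mem_preimage, SetLike.mem_coe, LinearPMap.mem_graph_iff]
  constructor
  · rintro ⟨v, rfl⟩
    exact ⟨v, rfl, rfl⟩
  · rintro ⟨v, h1, h2⟩
    exact ⟨v, WithLp.ofLp_injective 2 (Prod.ext h1 h2)⟩

instance : CompleteSpace (DSqrt A) := by
  have hiso : Isometry (toGraph A) := AddMonoidHomClass.isometry_of_norm _ fun _ => rfl
  rw [completeSpace_iff_isComplete_range hiso.isUniformInducing, range_toGraph]
  exact ((isClosed_sqrtOp A).preimage (WithLp.prod_continuous_ofLp 2 H H)).isComplete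

theorem norm_sq_eq (v : DSqrt A) : ‖v‖ ^ 2 = ‖toH A v‖ ^ 2 + ‖root A v‖ ^ 2 := by
  rw [norm_eq, Real.sq_sqrt (by positivity)]

theorem norm_toH_le (v : DSqrt A) : ‖toH A v‖ ≤ ‖v‖ :=
  le_of_sq_le_sq (by rw [norm_sq_eq]; linarith [sq_nonneg ‖root A v‖]) (norm_nonneg _)

theorem norm_root_le (v : DSqrt A) : ‖root A v‖ ≤ ‖v‖ :=
  le_of_sq_le_sq (by rw [norm_sq_eq]; linarith [sq_nonneg ‖toH A v‖]) (norm_nonneg _)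

variable (A) in
/-- The inclusion `D(A^{1/2}) → H` as a continuous linear map. -/
noncomputable def toHCLM : DSqrt A →L[ℝ] H :=
  (toH A).mkContinuous 1 fun v => by rw [one_mul]; exact norm_toH_le v

variable (A) in
/-- The map `A^{1/2} : D(A^{1/2}) → H`, continuous for the graph norm. -/
noncomputable def rootCLM : DSqrt A →L[ℝ] H :=
  (root A).mkContinuous 1 fun v => by rw [one_mul]; exact norm_root_le v

theorem continuous_toH : Continuous (toH A) := (toHCLM A).continuous

theorem continuous_root : Continuous (root A) := (rootCLM A).continuous

end DSqrt

open DSqrt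

variable {A : H →ₗ.[ℝ] H} {F : DSqrt A → ℝ} {gradF : DSqrt A → H}

/-! ### The nonlinearity -/

theorem IsGradient.isLittleO (h : IsGradient F gradF) (u : DSqrt A) :
    (fun v => F (u + v) - F u - ⟪gradF u, toH A v⟫_ℝ) =o[𝓝 0] fun v => toH A v := by
  rw [← Asymptotics.isLittleO_norm_right, ← nhdsNE_sup_pure, Asymptotics.isLittleO_sup]
  constructor
  · refine (Asymptotics.isLittleO_iff_tendsto' ?_).2 (h u)
    filter_upwards [self_mem_nhdsWithin] with v hv h0
    exact absurd (Subtype.ext (norm_eq_zero.1 h0)) hv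
  · exact Asymptotics.isLittleO_pure.2 (by simp)

theorem IsGradient.continuous (h : IsGradient F gradF) : Continuous F := by
  refine continuous_iff_continuousAt.2 fun u => ?_
  have h0 : Tendsto (fun v => toH A v) (𝓝 0) (𝓝 0) := by
    simpa using (continuous_toH (A := A)).tendsto 0
  have h1 := ((h.isLittleO u).trans_tendsto h0).add
    ((tendsto_const_nhds (x := gradF u)).inner (𝕜 := ℝ) h0)
  have h2 : Tendsto (fun v => F (u + v)) (𝓝 0) (𝓝 (F u)) := by
    simpa using h1.add_const (F u)
  have h3 : Tendsto (fun w => w - u) (𝓝 u) (𝓝 0) := by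
    simpa using (tendsto_id (x := 𝓝 u)).sub_const u
  simpa [ContinuousAt, Function.comp_def] using h2.comp h3

/-- The chain rule along a curve that is continuous in `D(A^{1/2})` and differentiable only
in `H`. The remainder in the definition of the gradient is small relative to the norm of `H`, which
is what makes this possible. -/
theorem IsGradient.hasDerivAt_comp (h : IsGradient F gradF) {u : ℝ → DSqrt A} {u' : H} {t : ℝ}
    (hc : ContinuousAt u t) (hd : HasDerivAt (fun s => toH A (u s)) u' t) :
    HasDerivAt (fun s => F (u s)) ⟪gradF (u t), u'⟫_ℝ t := by
  have h1 : Tendsto (fun s => u s - u t) (𝓝 t) (𝓝 0) := by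
    simpa using hc.tendsto.sub_const (u t)
  have h2 : (fun s => toH A (u s - u t)) =O[𝓝 t] fun s => s - t := by
    simpa only [map_sub] using hd.isBigO_sub
  have h3 := ((h.isLittleO (u t)).comp_tendsto h1).trans_isBigO h2
  have h4 := ((innerSL ℝ (gradF (u t))).hasFDerivAt.comp_hasDerivAt t hd)
  rw [hasDerivAt_iff_isLittleO] at h4 ⊢
  refine (h3.add h4).congr_left fun s => ?_
  simp [inner_sub_right]

theorem BoundedOnBounded.exists_norm_le {X Y : Type*} [Bornology X] [SeminormedAddCommGroup Y]
    {f : X → Y} (hf : BoundedOnBounded f) {s : Set X} (hs : Bornology.IsBounded s) :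
    ∃ C, ∀ x ∈ s, ‖f x‖ ≤ C := by
  obtain ⟨C, hC⟩ := (hf s hs).exists_norm_le
  exact ⟨C, fun x hx => hC _ (mem_image_of_mem f hx)⟩

theorem LocLipschitz.continuous (h : LocLipschitz gradF) : Continuous gradF := by
  obtain ⟨L, hL, hlip⟩ := h
  refine continuous_iff_continuousAt.2 fun v => ?_
  obtain ⟨C, hC⟩ := hL.exists_norm_le
    (Metric.isBounded_closedBall (x := (0 : ℝ × ℝ)) (r := ‖v‖ + 1))
  have h1 : Tendsto (fun w : DSqrt A => C * ‖w - v‖) (𝓝 v) (𝓝 0) := by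
    have : Continuous fun w : DSqrt A => C * ‖w - v‖ := by fun_prop
    simpa using this.tendsto v
  refine tendsto_iff_norm_sub_tendsto_zero.2 (squeeze_zero' (.of_forall fun _ => norm_nonneg _) ?_ h1)
  have h2 : ∀ᶠ w in 𝓝 v, ‖w‖ < ‖v‖ + 1 :=
    continuous_norm.continuousAt.eventually_lt continuousAt_const (lt_add_one _)
  filter_upwards [h2] with w hw
  refine (hlip w v).trans ?_
  gcongr
  refine (le_abs_self _).trans (hC _ ?_)
  rw [mem_closedBall_zero_iff, Prod.norm_def, norm_norm, norm_norm]
  exact max_le hw.le (lt_add_one _).le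

/-! ### Weak solutions -/

variable {u₀ : DSqrt A} {u₁ : H} {u : ℝ → DSqrt A} {u' : ℝ → H}

namespace IsWeakSolution

/-- A curve on `[0, ∞)`, extended to negative times by its initial value, is continuous on the whole
line. -/
theorem continuous_extension {X : Type*} [TopologicalSpace X] {f : ℝ → X}
    (hf : ContinuousOn f (Ici 0)) : Continuous fun t => f (max t 0) :=
  hf.comp_continuous (by fun_prop) fun _ => mem_Ici.2 (le_max_right _ _)

theorem extension_eventuallyEq {X : Type*} (f : ℝ → X) {t : ℝ} (ht : 0 < t) :
    (fun s => f (max s 0)) =ᶠ[𝓝 t] f := by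
  filter_upwards [Ioi_mem_nhds ht] with s hs
  rw [max_eq_left (le_of_lt hs)]

theorem hasDerivAt (hu : IsWeakSolution gradF u₀ u₁ u u') {t : ℝ} (ht : 0 < t) :
    HasDerivAt (fun s => toH A (u s)) (u' t) t :=
  (hu.hasDeriv t ht.le).hasDerivAt (Ici_mem_nhds ht)

/-- The dissipation of the energy. -/
theorem hasDerivAt_energy (hu : IsWeakSolution gradF u₀ u₁ u u') (hF : IsGradient F gradF)
    (hg : Continuous gradF) {t : ℝ} (ht : 0 < t) :
    HasDerivAt (fun s => (‖u' s‖ ^ 2 + ‖root A (u s)‖ ^ 2) / 2 + F (u s)) (-‖u' t‖ ^ 2) t := by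
  have hcu := continuous_extension hu.continuousOn
  have hcu' := continuous_extension hu.continuousOn_deriv
  have h1 := _root_.hasDerivAt_energy (i := toHCLM A) (b := rootCLM A)
    (g := fun t => u' (max t 0) + gradF (u (max t 0))) hcu hcu' (hcu'.add (hg.comp hcu))
    (fun t ht => ?_) (fun φ t ht => ?_) ht
  · have h2 := hF.hasDerivAt_comp (hu.continuousOn.continuousAt (Ici_mem_nhds ht))
      (hu.hasDerivAt ht)
    have h3 := h1.congr_of_eventuallyEq
      (extension_eventuallyEq (fun s => ‖u' s‖ ^ 2 + ‖root A (u s)‖ ^ 2) ht).symm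
    refine ((h3.div_const 2).add h2).congr_deriv ?_
    rw [max_eq_left ht.le, inner_add_left, real_inner_self_eq_norm_sq]
    ring
  · rw [max_eq_left ht.le]
    exact (hu.hasDerivAt ht).congr_of_eventuallyEq
      (extension_eventuallyEq (fun s => toH A (u s)) ht)
  · rw [max_eq_left ht.le]
    refine (((hu.weak φ t ht.le).hasDerivAt (Ici_mem_nhds ht)).congr_of_eventuallyEq
      (extension_eventuallyEq (fun s => ⟪u' s, toH A φ⟫_ℝ) ht)).congr_deriv ?_
    change _ = -(⟪u' t + gradF (u t), toH A φ⟫_ℝ + ⟪root A (u t), root A φ⟫_ℝ)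
    rw [inner_add_left]
    ring

/-- The equation tested with the solution itself. Only the continuity of `u'` is used to
differentiate the second factor, so no second derivative in `H` is needed. -/
theorem hasDerivAt_inner_self (hu : IsWeakSolution gradF u₀ u₁ u u') {t : ℝ} (ht : 0 < t) :
    HasDerivAt (fun s => ⟪u' s, toH A (u s)⟫_ℝ)
      (‖u' t‖ ^ 2 - ⟪u' t, toH A (u t)⟫_ℝ - ‖root A (u t)‖ ^ 2 -
        ⟪gradF (u t), toH A (u t)⟫_ℝ) t := by
  have h1 := ((hu.weak (u t) t ht.le).hasDerivAt (Ici_mem_nhds ht))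
  have h2 := hu.hasDerivAt ht
  have h3 : ContinuousAt u' t := hu.continuousOn_deriv.continuousAt (Ici_mem_nhds ht)
  rw [hasDerivAt_iff_tendsto_slope] at h1 h2 ⊢
  have h4 := h1.add ((h3.tendsto.mono_left nhdsWithin_le_nhds).inner (𝕜 := ℝ) h2)
  rw [real_inner_self_eq_norm_sq, real_inner_self_eq_norm_sq] at h4
  convert h4 using 2 with s
  · simp only [slope_def_module, inner_smul_right, inner_sub_right, smul_eq_mul]
    ring
  · ring

end IsWeakSolution

end DissipativeHyperbolic

/-! ### Decay of weak solutions -/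

theorem theorem2p2 {H : Type*} [NormedAddCommGroup H] [InnerProductSpace ℝ H] [CompleteSpace H]
    (A : H →ₗ.[ℝ] H) (hA_dense : Dense (A.domain : Set H)) (hA_sa : IsSelfAdjoint A)
    (hA_nonneg : DissipativeHyperbolic.IsNonneg A)
    (F : DissipativeHyperbolic.DSqrt A → ℝ) (hF_nonneg : ∀ u, 0 ≤ F u) (hF_zero : F 0 = 0)
    (gradF : DissipativeHyperbolic.DSqrt A → H)
    (h_grad : DissipativeHyperbolic.IsGradient F gradF)
    (h_lip : DissipativeHyperbolic.LocLipschitz gradF)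
    (h_K : ∃ K : ℝ, 0 < K ∧ ∀ u : DissipativeHyperbolic.DSqrt A,
      K * F u ≤ ⟪gradF u, DissipativeHyperbolic.DSqrt.toH A u⟫_ℝ)
    (p : ℝ) (hp : 0 < p)
    (h_R : ∃ R₁ : ℝ → ℝ, DissipativeHyperbolic.BoundedOnBounded R₁ ∧
      ∀ u : DissipativeHyperbolic.DSqrt A,
        ‖DissipativeHyperbolic.DSqrt.toH A u‖ ^ (p + 2) ≤
          R₁ ‖u‖ * (‖DissipativeHyperbolic.DSqrt.root A u‖ ^ 2 + F u))
    (u₀ : DissipativeHyperbolic.DSqrt A) (u₁ : H)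
    (u : ℝ → DissipativeHyperbolic.DSqrt A) (u' : ℝ → H)
    (hu : DissipativeHyperbolic.IsWeakSolution gradF u₀ u₁ u u') :
    ∃ M₁ M₂ : ℝ, ∀ t : ℝ, 0 ≤ t →
      ‖u' t‖ ^ 2 + ‖DissipativeHyperbolic.DSqrt.root A (u t)‖ ^ 2 + F (u t) ≤
          M₁ / (1 + t) ^ (1 + 2 / p) ∧
        ‖DissipativeHyperbolic.DSqrt.toH A (u t)‖ ≤ M₂ / (1 + t) ^ (1 / p) := by
  obtain ⟨K, hK, hKF⟩ := h_K
  obtain ⟨R₁, hR₁, hR⟩ := h_R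
  have hg := h_lip.continuous
  have hE := fun t (ht : 0 < t) => hu.hasDerivAt_energy h_grad hg ht
  have hP := fun t (ht : 0 < t) => hu.hasDerivAt_inner_self ht
  have hcH := DissipativeHyperbolic.DSqrt.continuous_toH.comp_continuousOn hu.continuousOn
  have hcE : ContinuousOn (fun t => (‖u' t‖ ^ 2 +
      ‖DissipativeHyperbolic.DSqrt.root A (u t)‖ ^ 2) / 2 + F (u t)) (Ici 0) :=
    (((hu.continuousOn_deriv.norm.pow 2).add
      ((DissipativeHyperbolic.DSqrt.continuous_root.comp_continuousOn
        hu.continuousOn).norm.pow 2)).div_const 2).add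
      (h_grad.continuous.comp_continuousOn hu.continuousOn)
  have hcP : ContinuousOn (fun t => ⟪u' t, DissipativeHyperbolic.DSqrt.toH A (u t)⟫_ℝ) (Ici 0) :=
    hu.continuousOn_deriv.inner hcH
  have hwd : ∀ t, 0 < t → HasDerivAt (fun t => ‖DissipativeHyperbolic.DSqrt.toH A (u t)‖ ^ 2)
      (2 * ⟪u' t, DissipativeHyperbolic.DSqrt.toH A (u t)⟫_ℝ) t := fun t ht => by
    rw [real_inner_comm]
    exact (hu.hasDerivAt ht).norm_sq
  -- The solution is bounded in `D(A^{1/2})`, so `R₁` may be replaced by a constant.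
  obtain ⟨B, hB⟩ : ∃ B, ∀ t, 0 ≤ t → ‖u t‖ ≤ B := by
    obtain ⟨D, hD⟩ := bounded_of_energy
      (w := fun t => ‖DissipativeHyperbolic.DSqrt.toH A (u t)‖) hcE hcP (hcH.norm.pow 2) hE hP hwd
      (fun t => by
        linarith [hF_nonneg (u t), sq_nonneg ‖DissipativeHyperbolic.DSqrt.root A (u t)‖])
      (fun t => abs_real_inner_le_norm _ _)
      (fun t => (mul_nonneg hK.le (hF_nonneg _)).trans (hKF (u t)))
    have hanti := antitoneOn_Ici_of_hasDerivAt_nonpos hcE hE fun t _ => neg_nonpos.2 (sq_nonneg _)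
    refine ⟨√(D + 2 * ((‖u' 0‖ ^ 2 + ‖DissipativeHyperbolic.DSqrt.root A (u 0)‖ ^ 2) / 2 + F (u 0))),
      fun t ht => Real.le_sqrt_of_sq_le ?_⟩
    rw [DissipativeHyperbolic.DSqrt.norm_sq_eq]
    refine add_le_add (hD t ht) (le_trans ?_
      (mul_le_mul_of_nonneg_left (hanti self_mem_Ici ht ht) zero_le_two))
    linarith [hF_nonneg (u t), sq_nonneg ‖u' t‖]
  obtain ⟨C, hC⟩ := hR₁.exists_norm_le (Metric.isBounded_Icc 0 B)
  have hC0 : 0 ≤ C := (norm_nonneg _).trans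
    (hC 0 ⟨le_rfl, (norm_nonneg _).trans (hB 0 le_rfl)⟩)
  have hwE : ∀ t, 0 ≤ t → ‖DissipativeHyperbolic.DSqrt.toH A (u t)‖ ^ (p + 2) ≤ 2 * C *
      ((‖u' t‖ ^ 2 + ‖DissipativeHyperbolic.DSqrt.root A (u t)‖ ^ 2) / 2 + F (u t)) := by
    intro t ht
    have hF0 := hF_nonneg (u t)
    calc _ ≤ C * (‖DissipativeHyperbolic.DSqrt.root A (u t)‖ ^ 2 + F (u t)) := by
          refine (hR (u t)).trans (mul_le_mul_of_nonneg_right ?_ (by positivity))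
          exact (le_abs_self _).trans (hC _ ⟨norm_nonneg _, hB t ht⟩)
      _ ≤ C * (2 * ((‖u' t‖ ^ 2 + ‖DissipativeHyperbolic.DSqrt.root A (u t)‖ ^ 2) / 2
            + F (u t))) := by
          gcongr
          linarith [sq_nonneg ‖u' t‖]
      _ = _ := by ring
  obtain ⟨M, hM, hdecay⟩ := energy_decay hp hK (by positivity) hcE hcP hE hP (fun _ => rfl)
    (fun t => hF_nonneg (u t)) (fun t => norm_nonneg _) (fun t => abs_real_inner_le_norm _ _)
    (fun t => hKF (u t)) hwE
  refine ⟨2 * M, (2 * C * M) ^ (1 / (p + 2)), fun t ht => ⟨?_, ?_⟩⟩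
  · rw [mul_div_assoc]
    linarith [hdecay t ht, hF_nonneg (u t)]
  · have h1 : ‖DissipativeHyperbolic.DSqrt.toH A (u t)‖ ^ (p + 2) ≤
        2 * C * M / (1 + t) ^ (1 + 2 / p) := by
      refine (hwE t ht).trans ?_
      rw [mul_div_assoc]
      exact mul_le_mul_of_nonneg_left (hdecay t ht) (by positivity)
    have h2 := Real.rpow_le_rpow (Real.rpow_nonneg (norm_nonneg _) _) h1
      (by positivity : 0 ≤ 1 / (p + 2))
    rw [← Real.rpow_mul (norm_nonneg _), mul_one_div_cancel (by positivity), Real.rpow_one,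
      Real.div_rpow (by positivity) (by positivity), ← Real.rpow_mul (by positivity)] at h2
    have h3 : (1 + 2 / p) * (1 / (p + 2)) = 1 / p := by field_simp
    rwa [h3] at h2
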